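/- Let $M$ be a smooth manifold of dimension $n$, let $F=\alpha+\beta$ be a Randers metric on $M$, where $\alpha(x,y)=\sqrt{g_x(y,y)}$ for a smooth Riemannian metric $g$ and $\beta=b_i(x)\,y^i$ is a smooth $1$-form with $\|\beta\|_\alpha<1$ at every point, and let $f\colon M\to\mathbb{R}$ be smooth. A Finsler metric with geodesic spray coefficients $G^i=\tfrac14 g^{il}\big([F^2]_{x^ky^l}y^k-[F^2]_{x^l}\big)$, where $(g^{il})$ is the inverse of the matrix $\big(\tfrac12[F^2]_{y^iy^l}\big)$, is said to be of Douglas type if in all local coordinates $(x^i,y^i)$ of $TM$ and at every point $x$ the functions $G^iy^j-G^jy^i$ of $y\neq 0$ are homogeneous polynomials of degree three in $y$. Suppose that $F$ is of Douglas type, and let $\tilde F=e^fF$. Then $\tilde F$ is of Douglas type if and only if $df$ and $\beta$ are proportional (that is, linearly dependent) at every point of $M$, i.e. in all local coordinates $$f_i\,b_j-f_j\,b_i=0\qquad\text{for all } i,j,\qquad\text{where } f_i=\frac{\partial f}{\partial x^i}.$$ -/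

import Mathlib

open scoped Manifold ContDiff

/-- Smooth differential 1-forms on an `n`-dimensional manifold `M`: smooth sections of the
cotangent bundle. -/
abbrev SmoothOneForm (n : ℕ) (M : Type*) [TopologicalSpace M]
    [ChartedSpace (EuclideanSpace ℝ (Fin n)) M] [IsManifold (𝓡 n) ∞ M] :=
  ContMDiffSection (𝓡 n) (EuclideanSpace ℝ (Fin n) →L[ℝ] ℝ) ∞
    (fun p : M => TangentSpace (𝓡 n) p →L[ℝ] Bundle.Trivial M ℝ p)

/-- The data of a Randers metric `F = α + β` on `M`: a smooth Riemannian metric `g`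
(with `α(v) = √(g(v, v))`) and a smooth 1-form `β` of pointwise `g`-norm less than one. -/
structure RandersMetric (n : ℕ) (M : Type*) [TopologicalSpace M]
    [ChartedSpace (EuclideanSpace ℝ (Fin n)) M] [IsManifold (𝓡 n) ∞ M] where
  /-- the Riemannian metric -/
  g : Bundle.ContMDiffRiemannianMetric (𝓡 n) ∞ (EuclideanSpace ℝ (Fin n))
    (fun p : M => TangentSpace (𝓡 n) p)
  /-- the 1-form -/
  β : SmoothOneForm n M
  /-- `‖β‖_α < 1` at every point -/
  norm_lt_one : ∀ p : M, ∃ c : ℝ, c < 1 ∧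
    ∀ v : TangentSpace (𝓡 n) p, |β p v| ≤ c * √(g.inner p v v)

noncomputable section

section Coordinates

variable {n : ℕ}

/-- The partial derivative `∂u/∂xⁱ` at `x` of a function `u` on `ℝⁿ`. -/
def partialD (i : Fin n) (u : EuclideanSpace ℝ (Fin n) → ℝ) (x : EuclideanSpace ℝ (Fin n)) : ℝ :=
  fderiv ℝ u x (EuclideanSpace.single i 1)

/-- The matrix `g_{ij}(x, y) = ½ ∂²(F²)/∂yⁱ∂yʲ` (fundamental tensor) of a function `F(x, y)`
of position `x` and direction `y`. -/
def fundamentalTensor (F : EuclideanSpace ℝ (Fin n) → EuclideanSpace ℝ (Fin n) → ℝ)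
    (x y : EuclideanSpace ℝ (Fin n)) : Matrix (Fin n) (Fin n) ℝ :=
  Matrix.of fun i j => (1 / 2) * partialD i (partialD j (fun w => F x w ^ 2)) y

/-- The geodesic spray coefficients
`Gⁱ = ¼ gⁱˡ ([F²]_{xᵏ yˡ} yᵏ - [F²]_{xˡ})`, with `(gⁱˡ)` the inverse of the fundamental tensor. -/
def sprayCoeff (F : EuclideanSpace ℝ (Fin n) → EuclideanSpace ℝ (Fin n) → ℝ) (i : Fin n)
    (x y : EuclideanSpace ℝ (Fin n)) : ℝ :=
  (1 / 4) * ∑ l, (fundamentalTensor F x y)⁻¹ i l *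
    ((∑ k, partialD k (fun z => partialD l (fun w => F z w ^ 2) y) x * y k) -
      partialD l (fun z => F z y ^ 2) x)

end Coordinates

section Manifold

variable {n : ℕ} {M : Type*} [TopologicalSpace M] [ChartedSpace (EuclideanSpace ℝ (Fin n)) M]

/-- The tangent vector `yⁱ ∂/∂xⁱ` at the point with coordinates `x` in the chart `φ`. -/
def coordVector (φ : OpenPartialHomeomorph M (EuclideanSpace ℝ (Fin n)))
    (x y : EuclideanSpace ℝ (Fin n)) : TangentSpace (𝓡 n) (φ.symm x) :=
  mfderiv (𝓡 n) (𝓡 n) φ.symm x y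

/-- The expression `F(x, y)` of a function `F` on the tangent bundle in the coordinates
`(xⁱ, yⁱ)` induced by a chart `φ`. -/
def coordExpr (F : (p : M) → TangentSpace (𝓡 n) p → ℝ)
    (φ : OpenPartialHomeomorph M (EuclideanSpace ℝ (Fin n)))
    (x y : EuclideanSpace ℝ (Fin n)) : ℝ :=
  F (φ.symm x) (coordVector φ x y)

/-- A Finsler metric `F` is of Douglas type (Bácsó–Matsumoto) if, in all local coordinates and at
every point, the functions `Gⁱ yʲ - Gʲ yⁱ` of `y ≠ 0` are homogeneous polynomials of degree three,
where `Gⁱ` are the spray coefficients of `F`. -/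
def IsDouglasType (F : (p : M) → TangentSpace (𝓡 n) p → ℝ) : Prop :=
  ∀ φ ∈ IsManifold.maximalAtlas (𝓡 n) ∞ M, ∀ x ∈ φ.target, ∀ i j : Fin n,
    ∃ P : MvPolynomial (Fin n) ℝ, P.IsHomogeneous 3 ∧
      ∀ y : EuclideanSpace ℝ (Fin n), y ≠ 0 →
        sprayCoeff (coordExpr F φ) i x y * y j - sprayCoeff (coordExpr F φ) j x y * y i =
          MvPolynomial.eval (fun k => y k) P

/-- The partial derivative `fᵢ = ∂f/∂xⁱ` of a function `f` on `M` in the chart `φ`. -/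
def coordPartial (φ : OpenPartialHomeomorph M (EuclideanSpace ℝ (Fin n))) (f : M → ℝ)
    (i : Fin n) (x : EuclideanSpace ℝ (Fin n)) : ℝ :=
  partialD i (fun z => f (φ.symm z)) x

namespace RandersMetric

variable [IsManifold (𝓡 n) ∞ M]

/-- The Finsler function `F = α + β`. -/
def toFun (R : RandersMetric n M) (p : M) (v : TangentSpace (𝓡 n) p) : ℝ :=
  √(R.g.inner p v v) + R.β p v

/-- The component `bᵢ = β(∂/∂xⁱ)` of the 1-form `β` in the chart `φ`. -/
def coordB (R : RandersMetric n M) (φ : OpenPartialHomeomorph M (EuclideanSpace ℝ (Fin n)))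
    (i : Fin n) (x : EuclideanSpace ℝ (Fin n)) : ℝ :=
  R.β (φ.symm x) (coordVector φ x (EuclideanSpace.single i 1))

end RandersMetric

/-- The conformal change `e^f F` of `F`. -/
def conformalChange (f : M → ℝ) (F : (p : M) → TangentSpace (𝓡 n) p → ℝ) (p : M)
    (v : TangentSpace (𝓡 n) p) : ℝ :=
  Real.exp (f p) * F p v

end Manifold

end

/-! ### Pointwise algebra and calculus of a Randers norm -/

section QuadraticForms

variable {E : Type*} [NormedAddCommGroup E] [NormedSpace ℝ E]

/-! Work at one point of one chart, with A = α², and let fs, bs be the A-duals of df and β. Under F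
↦ e^f F the spray changes by df(y) y − ½F² g⁻¹(df), where g is the fundamental tensor
(`sprayCoeff_exp_mul` together with Euler's identity). For a Randers norm, F² g⁻¹(df) = αF fs − α
df(y) bs modulo y (`randersTensor_dual_vector`). Multiples of y drop out of Gⁱyʲ − Gʲyⁱ, so that
expression changes by −½(α² fs∧y + α w∧y), with w = β(y) fs − df(y) bs
(`sprayCoeff_randersNorm_exp_mul`).

The α² term is a cubic polynomial, hence harmless. The term α w∧y is even in y while cubics are odd,
so the Douglas property survives iff w∧y = 0 for all y. Since A(w, y) = 0 always, w∧y = 0 forces w =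
0, that is β(y) df = df(y) β: proportionality. -/

/-- A positive definite bilinear form on a finite-dimensional space represents every covector. -/
theorem exists_dual_vector_of_pos [FiniteDimensional ℝ E] (A : E →L[ℝ] E →L[ℝ] ℝ)
    (hpos : ∀ v, v ≠ 0 → 0 < A v v) (θ : E →L[ℝ] ℝ) : ∃ u, ∀ v, A u v = θ v := by
  let T : E →ₗ[ℝ] Module.Dual ℝ E := (ContinuousLinearMap.coeLM ℝ).comp A.toLinearMap
  have hT : Function.Injective T := by
    rw [injective_iff_map_eq_zero]
    intro v hv
    by_contra h
    exact (hpos v h).ne' (by simpa [T] using LinearMap.congr_fun hv v)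
  obtain ⟨u, hu⟩ := (LinearMap.injective_iff_surjective_of_finrank_eq_finrank
    (Subspace.dual_finrank_eq (K := ℝ) (V := E)).symm).1 hT θ.toLinearMap
  exact ⟨u, fun v => by simpa [T] using LinearMap.congr_fun hu v⟩

/-- The Randers norm `√(A(w, w)) + B(w)` of a bilinear form `A` and a covector `B`. -/
noncomputable def randersNorm (A : E →L[ℝ] E →L[ℝ] ℝ) (B : E →L[ℝ] ℝ) (w : E) : ℝ :=
  √(A w w) + B w

/-- The fundamental tensor at `y` of the Randers norm. -/
noncomputable def randersTensor (A : E →L[ℝ] E →L[ℝ] ℝ) (B : E →L[ℝ] ℝ) (y u v : E) : ℝ :=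
  randersNorm A B y / √(A y y) * (A u v - A y u * A y v / A y y) +
    (A y u / √(A y y) + B u) * (A y v / √(A y y) + B v)

variable {A : E →L[ℝ] E →L[ℝ] ℝ} {B : E →L[ℝ] ℝ}

theorem hasFDerivAt_quadratic (A : E →L[ℝ] E →L[ℝ] ℝ) (w : E) :
    HasFDerivAt (fun w => A w w) (A w + A.flip w) w := by
  have := A.hasFDerivAt (x := w) |>.clm_apply (hasFDerivAt_id w)
  convert! this using 1

theorem hasFDerivAt_randersNorm (hA : ∀ u v, A u v = A v u) {w : E} (hw : 0 < A w w) :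
    HasFDerivAt (randersNorm A B) ((1 / √(A w w)) • A w + B) w := by
  have h := ((hasFDerivAt_quadratic A w).sqrt hw.ne').add B.hasFDerivAt
  refine h.congr_fderiv ?_
  ext v
  have := (Real.sqrt_pos.2 hw).ne'
  simp [hA v w]
  field_simp
  ring

theorem hasFDerivAt_randersNorm_sq (hA : ∀ u v, A u v = A v u) {w : E} (hw : 0 < A w w) :
    HasFDerivAt (fun w => randersNorm A B w ^ 2)
      ((2 * randersNorm A B w) • ((1 / √(A w w)) • A w + B)) w := by
  refine ((hasFDerivAt_randersNorm (B := B) hA hw).pow 2).congr_fderiv ?_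
  simp

/-- The function differentiated here is the v-derivative of F², so half of the result is
`randersTensor`. -/
theorem hasFDerivAt_fderiv_randersNorm_sq (hA : ∀ u v, A u v = A v u) {y : E} (hy : 0 < A y y)
    (v : E) : HasFDerivAt (fun w => 2 * randersNorm A B w * (A w v / √(A w w) + B v))
      ((2 * randersNorm A B y) • ((1 / √(A y y)) • A.flip v - (A y v / √(A y y) ^ 3) • A y) +
        (2 * (A y v / √(A y y) + B v)) • ((1 / √(A y y)) • A y + B)) y := by
  have hs := (Real.sqrt_pos.2 hy).ne'
  have h := ((hasFDerivAt_randersNorm (B := B) hA hy).const_mul 2).mul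
    (((A.flip v).hasFDerivAt (x := y) |>.mul
      ((hasDerivAt_inv hs).comp_hasFDerivAt y ((hasFDerivAt_quadratic A y).sqrt hy.ne')))
        |>.add_const (B v))
  refine (h.congr_fderiv ?_).congr_of_eventuallyEq (Filter.Eventually.of_forall fun w => ?_)
  · ext u
    simp [hA u y]
    field_simp
    ring
  · simp [div_eq_mul_inv]

/-- The Randers fundamental tensor at `y` carries an explicit vector to a given covector. -/
theorem randersTensor_dual_vector {y fs bs : E} (hA : ∀ u v, A u v = A v u) {θ : E →L[ℝ] ℝ}
    (hy : 0 < A y y) (hF : 0 < randersNorm A B y) (hf : ∀ v, A fs v = θ v)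
    (hb : ∀ v, A bs v = B v) :
    ∃ c : ℝ, ∀ v, randersTensor A B y v ((√(A y y) / randersNorm A B y) • fs -
      (√(A y y) * θ y / randersNorm A B y ^ 2) • bs + c • y) = θ v := by
  have hs := Real.sqrt_pos.2 hy
  have hsq : A y y = √(A y y) ^ 2 := (Real.sq_sqrt hy.le).symm
  have hFe : randersNorm A B y = √(A y y) + B y := rfl
  simp only [randersTensor]
  generalize hr : √(A y y) = r at *
  generalize hFF : randersNorm A B y = F at *
  have hBy : B y = F - r := by linarith
  -- For the sought X, pairing with y gives F·dF(X) = θ(y), where dF is taken at y. The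
  -- bs-coefficient is what cancels B v under this condition, and c is solved from dF(X) = θ(y)/F
  -- using dF(y) = F.
  refine ⟨-(r / F * (θ y / r + B fs) - r * θ y / F ^ 2 * (B y / r + B bs)) / F + θ y / F ^ 2,
    fun v => ?_⟩
  have e1 : A v fs = θ v := by rw [hA, hf]
  have e2 : A v bs = B v := by rw [hA, hb]
  have e3 : A y fs = θ y := by rw [hA, hf]
  have e4 : A y bs = B y := by rw [hA, hb]
  simp only [map_add, map_sub, map_smul, smul_eq_mul, e1, e2, e3, e4, hA v y, hsq, hBy]
  field_simp
  ring

end QuadraticForms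

/-! ### Spray coefficients and their conformal change -/

section Spray

variable {n : ℕ}

theorem sum_coord_mul_apply_single (θ : EuclideanSpace ℝ (Fin n) →L[ℝ] ℝ)
    (y : EuclideanSpace ℝ (Fin n)) :
    ∑ k, θ (EuclideanSpace.single k 1) * y k = θ y := by
  conv_rhs => rw [← (EuclideanSpace.basisFun (Fin n) ℝ).sum_repr y]
  simp [mul_comm]

/-- The change of the spray coefficients under a conformal change. -/
theorem sprayCoeff_exp_mul (F : EuclideanSpace ℝ (Fin n) → EuclideanSpace ℝ (Fin n) → ℝ)
    (h : EuclideanSpace ℝ (Fin n) → ℝ) (x y : EuclideanSpace ℝ (Fin n)) (i : Fin n)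
    (hh : DifferentiableAt ℝ h x)
    (hdet : IsUnit (fundamentalTensor F x y).det)
    (hF : DifferentiableAt ℝ (fun z => F z y ^ 2) x)
    (hF' : ∀ l, DifferentiableAt ℝ (fun z => partialD l (fun w => F z w ^ 2) y) x) :
    sprayCoeff (fun z w => Real.exp (h z) * F z w) i x y =
      sprayCoeff F i x y + (1 / 2) * ∑ l, (fundamentalTensor F x y)⁻¹ i l *
        (fderiv ℝ h x y * partialD l (fun w => F x w ^ 2) y - F x y ^ 2 * partialD l h x) := by
  have hsq : ∀ z w, (Real.exp (h z) * F z w) ^ 2 = Real.exp (2 * h z) * F z w ^ 2 := fun z w => by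
    rw [mul_pow, ← Real.exp_nat_mul]; norm_num
  have hpm : ∀ (c : ℝ) (u : EuclideanSpace ℝ (Fin n) → ℝ) (l : Fin n)
      (w : EuclideanSpace ℝ (Fin n)),
      partialD l (fun w => c * u w) w = c * partialD l u w := fun c u l w => by
    simp only [partialD]
    rw [show (fun w => c * u w) = c • u from rfl, fderiv_const_smul_field]; simp
  have hexp : HasFDerivAt (fun z => Real.exp (2 * h z))
      ((Real.exp (2 * h x)) • ((2 : ℝ) • fderiv ℝ h x)) x := (hh.hasFDerivAt.const_mul 2).exp
  have hprod : ∀ (u : EuclideanSpace ℝ (Fin n) → ℝ) (k : Fin n), DifferentiableAt ℝ u x →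
      partialD k (fun z => Real.exp (2 * h z) * u z) x =
        Real.exp (2 * h x) * (partialD k u x + 2 * partialD k h x * u x) := fun u k hu => by
    simp only [partialD]
    rw [show (fun z => Real.exp (2 * h z) * u z) = (fun z => Real.exp (2 * h z)) * u from rfl,
      (hexp.mul hu.hasFDerivAt).fderiv]
    simp
    ring
  have hT : fundamentalTensor (fun z w => Real.exp (h z) * F z w) x y =
      Units.mk0 (Real.exp (2 * h x)) (Real.exp_pos _).ne' • fundamentalTensor F x y := by
    ext a b
    simp only [fundamentalTensor, hsq, Matrix.of_apply, Matrix.smul_apply, Units.smul_mk0,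
      smul_eq_mul]
    rw [show partialD b (fun w => Real.exp (2 * h x) * F x w ^ 2) =
      fun w => Real.exp (2 * h x) * partialD b (fun w => F x w ^ 2) w from
        funext fun w => hpm _ _ _ _, hpm]
    ring
  simp only [sprayCoeff]
  -- The factor e^{2h} of F² cancels against its inverse from the fundamental tensor; only the
  -- derivatives of h survive.
  rw [hT, Matrix.inv_smul' _ _ hdet, Finset.mul_sum, Finset.mul_sum, Finset.mul_sum,
    ← Finset.sum_add_distrib]
  refine Finset.sum_congr rfl fun l _ => ?_
  simp only [hsq, hpm, Matrix.smul_apply]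
  rw [hprod _ _ hF, Finset.sum_congr rfl fun k _ => by rw [hprod _ k (hF' l)]]
  have hsum := sum_coord_mul_apply_single (fderiv ℝ h x) y
  have : ∑ k, Real.exp (2 * h x) * (partialD k (fun z => partialD l (fun w => F z w ^ 2) y) x +
      2 * partialD k h x * partialD l (fun w => F x w ^ 2) y) * y k =
      Real.exp (2 * h x) * ((∑ k, partialD k (fun z => partialD l (fun w => F z w ^ 2) y) x * y k) +
        2 * fderiv ℝ h x y * partialD l (fun w => F x w ^ 2) y) := by
    rw [← hsum, Finset.mul_sum, Finset.sum_mul, ← Finset.sum_add_distrib, Finset.mul_sum]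
    exact Finset.sum_congr rfl fun k _ => by simp only [partialD]; ring
  rw [this]
  have he := (Real.exp_pos (2 * h x)).ne'
  simp only [Units.smul_def, Units.val_inv_eq_inv_val, Units.val_mk0, smul_eq_mul]
  field_simp
  ring

variable {A : EuclideanSpace ℝ (Fin n) →L[ℝ] EuclideanSpace ℝ (Fin n) →L[ℝ] ℝ}
    {B : EuclideanSpace ℝ (Fin n) →L[ℝ] ℝ}

theorem partialD_randersNorm_sq (hA : ∀ u v, A u v = A v u) {w : EuclideanSpace ℝ (Fin n)}
    (hw : 0 < A w w)
    (l : Fin n) : partialD l (fun w => randersNorm A B w ^ 2) w =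
      2 * randersNorm A B w * (A w (EuclideanSpace.single l 1) / √(A w w) +
        B (EuclideanSpace.single l 1)) := by
  rw [partialD, (hasFDerivAt_randersNorm_sq hA hw).fderiv]
  simp [div_eq_inv_mul]
  ring

theorem fundamentalTensor_randersNorm
    {A : EuclideanSpace ℝ (Fin n) →
      EuclideanSpace ℝ (Fin n) →L[ℝ] EuclideanSpace ℝ (Fin n) →L[ℝ] ℝ} {B : EuclideanSpace ℝ
      (Fin n) → EuclideanSpace ℝ (Fin n) →L[ℝ] ℝ} {x y : EuclideanSpace ℝ (Fin n)}
    (hA : ∀ u v, A x u v = A x v u) (hy : 0 < A x y y) (i j : Fin n) :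
    fundamentalTensor (fun z => randersNorm (A z) (B z)) x y i j =
      randersTensor (A x) (B x) y (EuclideanSpace.single i 1) (EuclideanSpace.single j 1) := by
  -- The formula for the first derivative needs A(w, w) > 0, an open condition, so it can be
  -- differentiated again at y.
  have hev : partialD j (fun w => randersNorm (A x) (B x) w ^ 2) =ᶠ[nhds y] fun w =>
      2 * randersNorm (A x) (B x) w * (A x w (EuclideanSpace.single j 1) / √(A x w w) +
        B x (EuclideanSpace.single j 1)) := by
    have hc : Continuous fun w => A x w w := by fun_prop
    filter_upwards [hc.continuousAt.eventually (lt_mem_nhds hy)] with w hw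
    exact partialD_randersNorm_sq hA hw j
  simp only [fundamentalTensor, Matrix.of_apply]
  rw [partialD, hev.fderiv_eq, (hasFDerivAt_fderiv_randersNorm_sq hA hy _).fderiv]
  have hs := (Real.sqrt_pos.2 hy).ne'
  have hsq : A x y y = √(A x y y) ^ 2 := (Real.sq_sqrt hy.le).symm
  simp only [randersTensor]
  generalize √(A x y y) = r at *
  simp
  rw [hsq]
  field_simp

theorem randersTensor_sum (A : EuclideanSpace ℝ (Fin n) →L[ℝ] EuclideanSpace ℝ (Fin n) →L[ℝ] ℝ)
    (B : EuclideanSpace ℝ (Fin n) →L[ℝ] ℝ) (y u X : EuclideanSpace ℝ (Fin n)) :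
    ∑ j, randersTensor A B y u (EuclideanSpace.single j 1) * X j = randersTensor A B y u X := by
  let θ : EuclideanSpace ℝ (Fin n) →L[ℝ] ℝ := (randersNorm A B y / √(A y y)) •
      (A u - (A y u / A y y) • A y) +
    (A y u / √(A y y) + B u) • ((1 / √(A y y)) • A y + B)
  have hθ : ∀ v, θ v = randersTensor A B y u v := fun v => by
    simp [θ, randersTensor]; ring
  simp only [← hθ]
  exact sum_coord_mul_apply_single θ X

/-- The contravariant form of `dh`, scaled by `F²`, enters the conformal change of the
expressions `Gⁱ yʲ - Gʲ yⁱ` of a Randers metric. -/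
theorem sprayCoeff_randersNorm_exp_mul
    {A : EuclideanSpace ℝ (Fin n) →
      EuclideanSpace ℝ (Fin n) →L[ℝ] EuclideanSpace ℝ (Fin n) →L[ℝ] ℝ}
    {B : EuclideanSpace ℝ (Fin n) → EuclideanSpace ℝ (Fin n) →L[ℝ] ℝ}
    {h : EuclideanSpace ℝ (Fin n) → ℝ} {x y fs bs : EuclideanSpace ℝ (Fin n)}
    (hA : ∀ z u v, A z u v = A z v u) (hpos : ∀ v, v ≠ 0 → 0 < A x v v)
    (hF : 0 < randersNorm (A x) (B x) y) (hy : y ≠ 0)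
    (hAd : ∀ u v, DifferentiableAt ℝ (fun z => A z u v) x)
    (hBd : ∀ v, DifferentiableAt ℝ (fun z => B z v) x)
    (hh : DifferentiableAt ℝ h x)
    (hf : ∀ v, A x fs v = fderiv ℝ h x v) (hb : ∀ v, A x bs v = B x v) (i j : Fin n) :
    sprayCoeff (fun z w => Real.exp (h z) * randersNorm (A z) (B z) w) i x y * y j -
      sprayCoeff (fun z w => Real.exp (h z) * randersNorm (A z) (B z) w) j x y * y i =
    sprayCoeff (fun z => randersNorm (A z) (B z)) i x y * y j -
      sprayCoeff (fun z => randersNorm (A z) (B z)) j x y * y i -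
      (1 / 2) * (A x y y * (fs i * y j - fs j * y i) + √(A x y y) *
        (B x y * (fs i * y j - fs j * y i) - fderiv ℝ h x y * (bs i * y j - bs j * y i))) := by
  have hAy := hpos y hy
  have hr := Real.sqrt_pos.2 hAy
  have hsq : A x y y = √(A x y y) ^ 2 := (Real.sq_sqrt hAy.le).symm
  -- Positivity is assumed only over x; continuity extends it to nearby base points for this fixed
  -- y.
  have hnear : ∀ᶠ z in nhds x, 0 < A z y y :=
    (hAd y y).continuousAt.eventually (lt_mem_nhds hAy)
  have hFd : DifferentiableAt ℝ (fun z => randersNorm (A z) (B z) y) x :=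
    ((hAd y y).sqrt hAy.ne').add (hBd y)
  have hF'd : ∀ l, DifferentiableAt ℝ
      (fun z => partialD l (fun w => randersNorm (A z) (B z) w ^ 2) y) x := fun l => by
    have hrd : DifferentiableAt ℝ (fun z => √(A z y y)) x := (hAd y y).sqrt hAy.ne'
    have : DifferentiableAt ℝ (fun z => 2 * randersNorm (A z) (B z) y *
        (A z y (EuclideanSpace.single l 1) / √(A z y y) + B z (EuclideanSpace.single l 1))) x := by
        simp only [div_eq_mul_inv]
        exact (hFd.const_mul 2).mul (((hAd _ _).mul (hrd.inv hr.ne')).add (hBd _))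
    refine this.congr_of_eventuallyEq ?_
    filter_upwards [hnear] with z hz
    exact partialD_randersNorm_sq (hA z) hz l
  set T := fundamentalTensor (fun z => randersNorm (A z) (B z)) x y with hTdef
  have hTmul : ∀ X : EuclideanSpace ℝ (Fin n), T.mulVec X = fun k =>
      randersTensor (A x) (B x) y (EuclideanSpace.single k 1) X := fun X => by
    ext k
    simp only [Matrix.mulVec, dotProduct, hTdef, fundamentalTensor_randersNorm (hA x) hAy]
    exact randersTensor_sum _ _ _ _ _
  -- Explicit solvability for every covector already makes the fundamental tensor invertible.
  have hdet : IsUnit T.det := by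
    rw [← Matrix.isUnit_iff_isUnit_det, ← Matrix.mulVec_surjective_iff_isUnit]
    intro t
    let θ : EuclideanSpace ℝ (Fin n) →L[ℝ] ℝ := innerSL ℝ (WithLp.toLp 2 t)
    obtain ⟨u, hu⟩ := exists_dual_vector_of_pos (A x) hpos θ
    obtain ⟨c, hc⟩ := randersTensor_dual_vector (hA x) hAy hF hu hb
    refine ⟨_, (hTmul _).trans (funext fun k => (hc _).trans ?_)⟩
    simp [θ, EuclideanSpace.inner_single_right]
  have hinv : ∀ (X : EuclideanSpace ℝ (Fin n)) (θ : EuclideanSpace ℝ (Fin n) →L[ℝ] ℝ),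
      (∀ v, randersTensor (A x) (B x) y v X = θ v) →
      ∀ k, ∑ l, T⁻¹ k l * θ (EuclideanSpace.single l 1) = X k := fun X θ hX k => by
    have h1 : T.mulVec X = fun l => θ (EuclideanSpace.single l 1) := by
      rw [hTmul]; exact funext fun l => hX _
    have h2 : T⁻¹.mulVec (T.mulVec X) = X := by
      rw [Matrix.mulVec_mulVec, Matrix.nonsing_inv_mul _ hdet, Matrix.one_mulVec]
    rw [h1] at h2
    exact congrFun h2 k
  obtain ⟨c, hc⟩ := randersTensor_dual_vector (hA x) hAy hF hf hb
  -- Euler's identity: the fundamental tensor sends y to F·dF = ½ d(F²).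
  have hdF := hinv y (randersNorm (A x) (B x) y • ((1 / √(A x y y)) • A x y + B x)) fun v => by
    simp only [randersTensor, hA x v y]
    have : randersNorm (A x) (B x) y = √(A x y y) + B x y := rfl
    simp
    field_simp
    rw [this]
    ring
  have key : ∀ k, sprayCoeff (fun z w => Real.exp (h z) * randersNorm (A z) (B z) w) k x y =
      sprayCoeff (fun z => randersNorm (A z) (B z)) k x y + fderiv ℝ h x y * y k -
        (1 / 2) * (√(A x y y) * randersNorm (A x) (B x) y * fs k -
          √(A x y y) * fderiv ℝ h x y * bs k + randersNorm (A x) (B x) y ^ 2 * c * y k) :=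
      fun k => by
    rw [sprayCoeff_exp_mul _ _ _ _ _ hh hdet (hFd.pow 2) hF'd]
    have e1 := hdF k
    have e2 := hinv _ _ hc k
    have : ∑ l, T⁻¹ k l * (fderiv ℝ h x y *
        partialD l (fun w => randersNorm (A x) (B x) w ^ 2) y -
          randersNorm (A x) (B x) y ^ 2 * partialD l h x) =
        2 * fderiv ℝ h x y * y k - randersNorm (A x) (B x) y ^ 2 *
          ∑ l, T⁻¹ k l * fderiv ℝ h x (EuclideanSpace.single l 1) := by
      rw [← e1, Finset.mul_sum, Finset.mul_sum, ← Finset.sum_sub_distrib]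
      refine Finset.sum_congr rfl fun l _ => ?_
      rw [partialD_randersNorm_sq (hA x) hAy, partialD]
      simp
      ring
    rw [this, e2]
    simp
    field_simp
    ring
  -- All multiples of y in `key`, including the unspecified c, cancel on antisymmetrizing.
  rw [key, key]
  have hFe : randersNorm (A x) (B x) y = √(A x y y) + B x y := rfl
  rw [hFe]
  generalize √(A x y y) = r at *
  rw [hsq]
  ring

end Spray

/-! ### Parity of homogeneous polynomials -/

section Homogeneous

theorem MvPolynomial.IsHomogeneous.eval_neg_of_odd {σ : Type*} {P : MvPolynomial σ ℝ} {d : ℕ}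
    (hP : P.IsHomogeneous d) (hd : Odd d) (y : σ → ℝ) :
    MvPolynomial.eval (fun k => -y k) P = -MvPolynomial.eval y P := by
  rw [MvPolynomial.eval_eq, MvPolynomial.eval_eq, ← Finset.sum_neg_distrib]
  refine Finset.sum_congr rfl fun m hm => ?_
  have hm' := hP (MvPolynomial.mem_support_iff.1 hm)
  have : ∏ i ∈ m.support, (-y i) ^ m i = (-1) ^ d * ∏ i ∈ m.support, y i ^ m i := by
    rw [← hm', Finsupp.weight_apply, Finsupp.sum, ← Finset.prod_pow_eq_pow_sum,
      ← Finset.prod_mul_distrib]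
    refine Finset.prod_congr rfl fun i _ => ?_
    rw [neg_pow]
    simp
  rw [this, hd.neg_one_pow]
  ring

end Homogeneous

/-! ### Coordinate expressions of the metric and the 1-form -/

section CoordinateSmoothness

variable {n : ℕ} {M : Type*} [TopologicalSpace M] [ChartedSpace (EuclideanSpace ℝ (Fin n)) M]
  {φ : OpenPartialHomeomorph M (EuclideanSpace ℝ (Fin n))} {x : EuclideanSpace ℝ (Fin n)}

/-- Differentiating φ ∘ φ⁻¹ = id near x gives the derivative of φ⁻¹ a left inverse. -/
theorem coordVector_ne_zero (hφ : φ ∈ IsManifold.maximalAtlas (𝓡 n) ∞ M) (hx : x ∈ φ.target)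
    {v : EuclideanSpace ℝ (Fin n)} (hv : v ≠ 0) : coordVector φ x v ≠ 0 := by
  have hm : MDifferentiableAt (𝓡 n) (𝓡 n) φ (φ.symm x) :=
    (contMDiffAt_of_mem_maximalAtlas hφ (φ.map_target hx)).mdifferentiableAt (by simp)
  have hs : MDifferentiableAt (𝓡 n) (𝓡 n) φ.symm x :=
    (contMDiffAt_symm_of_mem_maximalAtlas hφ hx).mdifferentiableAt (by simp)
  have hid : φ ∘ φ.symm =ᶠ[nhds x] id := φ.eventually_right_inverse hx
  have hc := mfderiv_comp x hm hs
  rw [hid.mfderiv_eq, mfderiv_id] at hc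
  intro h0
  have := DFunLike.congr_fun hc v
  refine hv (this.trans ?_)
  change mfderiv (𝓡 n) (𝓡 n) φ (φ.symm x) (coordVector φ x v) = 0
  rw [h0, map_zero]

theorem differentiableAt_comp_symm (hφ : φ ∈ IsManifold.maximalAtlas (𝓡 n) ∞ M)
    (hx : x ∈ φ.target) {f : M → ℝ} (hf : ContMDiff (𝓡 n) 𝓘(ℝ, ℝ) ∞ f) :
    DifferentiableAt ℝ (fun z => f (φ.symm z)) x :=
  (hf.contMDiffAt.comp x (contMDiffAt_symm_of_mem_maximalAtlas hφ hx)).mdifferentiableAt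
    (by simp) |>.differentiableAt

variable [IsManifold (𝓡 n) ∞ M]

/-- The coordinate vector fields of a smooth chart are differentiable. -/
theorem mdifferentiableAt_coordVector (hφ : φ ∈ IsManifold.maximalAtlas (𝓡 n) ∞ M)
    (hx : x ∈ φ.target) (u : EuclideanSpace ℝ (Fin n)) :
    MDifferentiableAt (𝓡 n) ((𝓡 n).prod 𝓘(ℝ, EuclideanSpace ℝ (Fin n)))
      (fun z => Bundle.TotalSpace.mk' (EuclideanSpace ℝ (Fin n))
        (E := fun p : M => TangentSpace (𝓡 n) p) (φ.symm z) (coordVector φ z u)) x := by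
  have hs : ContMDiffAt (𝓡 n) (𝓡 n) ∞ φ.symm x := contMDiffAt_symm_of_mem_maximalAtlas hφ hx
  -- The derivative costs one order of smoothness; keeping C¹ is enough.
  have hD := hs.mfderiv_const (m := 1)
    (show (1 : WithTop ℕ∞) + 1 ≤ ∞ by rw [one_add_one_eq_two]; exact WithTop.coe_le_coe.2 le_top)
  have hu : ContMDiffAt (𝓡 n) ((𝓡 n).prod 𝓘(ℝ, EuclideanSpace ℝ (Fin n))) 1
      (fun z : EuclideanSpace ℝ (Fin n) => Bundle.TotalSpace.mk' (EuclideanSpace ℝ (Fin n))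
        (E := fun p : EuclideanSpace ℝ (Fin n) => TangentSpace (𝓡 n) p) z u) x := by
    rw [Bundle.contMDiffAt_totalSpace]
    refine ⟨contMDiffAt_id, ?_⟩
    simpa using contMDiffAt_const
  have := ContMDiffAt.clm_apply_of_inCoordinates (b₁ := id) (b₂ := φ.symm) (v := fun _ => u)
    (ϕ := fun z => mfderiv (𝓡 n) (𝓡 n) φ.symm z) hD hu (hs.of_le (by norm_num))
  exact this.mdifferentiableAt one_ne_zero

variable (R : RandersMetric n M) (φ)

/-- The bilinear form `g_{ij}(z)` of the Riemannian metric in a chart. -/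
noncomputable def RandersMetric.coordMetric (z : EuclideanSpace ℝ (Fin n)) :
    EuclideanSpace ℝ (Fin n) →L[ℝ] EuclideanSpace ℝ (Fin n) →L[ℝ] ℝ :=
  let G : EuclideanSpace ℝ (Fin n) →L[ℝ] EuclideanSpace ℝ (Fin n) →L[ℝ] ℝ := R.g.inner (φ.symm z)
  let D : EuclideanSpace ℝ (Fin n) →L[ℝ] EuclideanSpace ℝ (Fin n) :=
    mfderiv (𝓡 n) (𝓡 n) φ.symm z
  G.bilinearComp D D

/-- The covector `b_i(z)` of the 1-form in a chart. -/
noncomputable def RandersMetric.coordForm (z : EuclideanSpace ℝ (Fin n)) :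
    EuclideanSpace ℝ (Fin n) →L[ℝ] ℝ :=
  ContinuousLinearMap.comp (R.β (φ.symm z) : TangentSpace (𝓡 n) (φ.symm z) →L[ℝ] ℝ)
    (mfderiv (𝓡 n) (𝓡 n) φ.symm z)

variable {φ}

theorem RandersMetric.differentiableAt_coordMetric
    (hφ : φ ∈ IsManifold.maximalAtlas (𝓡 n) ∞ M) (hx : x ∈ φ.target)
    (u v : EuclideanSpace ℝ (Fin n)) :
    DifferentiableAt ℝ (fun z => R.coordMetric φ z u v) x := by
  have hs : ContMDiffAt (𝓡 n) (𝓡 n) ∞ φ.symm x := contMDiffAt_symm_of_mem_maximalAtlas hφ hx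
  have hg := (R.g.contMDiff.contMDiffAt.comp x hs).mdifferentiableAt (by simp)
  have := MDifferentiableAt.clm_bundle_apply₂ (F₁ := EuclideanSpace ℝ (Fin n))
    (F₂ := EuclideanSpace ℝ (Fin n)) (F₃ := ℝ) (E₃ := Bundle.Trivial M ℝ) (b := φ.symm)
    (ψ := fun z => R.g.inner (φ.symm z)) hg
    (mdifferentiableAt_coordVector hφ hx u) (mdifferentiableAt_coordVector hφ hx v)
  rw [mdifferentiableAt_totalSpace] at this
  exact this.2.differentiableAt

theorem RandersMetric.differentiableAt_coordForm
    (hφ : φ ∈ IsManifold.maximalAtlas (𝓡 n) ∞ M) (hx : x ∈ φ.target)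
    (v : EuclideanSpace ℝ (Fin n)) :
    DifferentiableAt ℝ (fun z => R.coordForm φ z v) x := by
  have hs : ContMDiffAt (𝓡 n) (𝓡 n) ∞ φ.symm x := contMDiffAt_symm_of_mem_maximalAtlas hφ hx
  have hβ := (R.β.contMDiff_toFun.contMDiffAt.comp x hs).mdifferentiableAt (by simp)
  have := MDifferentiableAt.clm_bundle_apply (F₁ := EuclideanSpace ℝ (Fin n))
    (F₂ := ℝ) (E₂ := Bundle.Trivial M ℝ) (b := φ.symm)
    (ϕ := fun z => R.β (φ.symm z)) hβ (mdifferentiableAt_coordVector hφ hx v)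
  rw [mdifferentiableAt_totalSpace] at this
  exact this.2.differentiableAt

theorem RandersMetric.coordMetric_pos (hφ : φ ∈ IsManifold.maximalAtlas (𝓡 n) ∞ M)
    (hx : x ∈ φ.target) {v : EuclideanSpace ℝ (Fin n)} (hv : v ≠ 0) :
    0 < R.coordMetric φ x v v :=
  R.g.pos _ _ (coordVector_ne_zero hφ hx hv)

theorem RandersMetric.randersNorm_pos (hφ : φ ∈ IsManifold.maximalAtlas (𝓡 n) ∞ M)
    (hx : x ∈ φ.target) {v : EuclideanSpace ℝ (Fin n)} (hv : v ≠ 0) :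
    0 < randersNorm (R.coordMetric φ x) (R.coordForm φ x) v := by
  obtain ⟨c, hc, hle⟩ := R.norm_lt_one (φ.symm x)
  have h1 : |R.coordForm φ x v| ≤ c * √(R.coordMetric φ x v v) := hle (coordVector φ x v)
  have h2 := Real.sqrt_pos.2 (R.coordMetric_pos hφ hx hv)
  have h3 := (abs_le.1 h1).1
  unfold randersNorm
  nlinarith

end CoordinateSmoothness

/-! ### The equivalence, at each point of each chart -/

theorem corollary2p6 {n : ℕ} {M : Type*} [TopologicalSpace M]
    [ChartedSpace (EuclideanSpace ℝ (Fin n)) M] [IsManifold (𝓡 n) ∞ M]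
    (R : RandersMetric n M) (hR : IsDouglasType R.toFun)
    (f : M → ℝ) (hf : ContMDiff (𝓡 n) 𝓘(ℝ, ℝ) ∞ f) :
    IsDouglasType (conformalChange f R.toFun) ↔
      ∀ φ ∈ IsManifold.maximalAtlas (𝓡 n) ∞ M, ∀ x ∈ φ.target, ∀ i j : Fin n,
        coordPartial φ f i x * R.coordB φ j x - coordPartial φ f j x * R.coordB φ i x = 0 := by
  refine forall_congr' fun φ => forall_congr' fun hφ => forall_congr' fun x =>
    forall_congr' fun hx => ?_
  set A := R.coordMetric φ with hAdef
  set B := R.coordForm φ with hBdef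
  set df := fderiv ℝ (fun z => f (φ.symm z)) x with hdf
  have hpos : ∀ v, v ≠ 0 → 0 < A x v v := fun v hv => R.coordMetric_pos hφ hx hv
  have hsymm : ∀ z u v, A z u v = A z v u := fun z u v => R.g.symm _ _ _
  obtain ⟨fs, hfs⟩ := exists_dual_vector_of_pos (A x) hpos df
  obtain ⟨bs, hbs⟩ := exists_dual_vector_of_pos (A x) hpos (B x)
  -- The coordinate expressions unfold definitionally to `randersNorm` of `A` and `B`, so the
  -- Euclidean formula applies directly.
  have key : ∀ (i j : Fin n) (y : EuclideanSpace ℝ (Fin n)), y ≠ 0 →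
      sprayCoeff (coordExpr (conformalChange f R.toFun) φ) i x y * y j -
        sprayCoeff (coordExpr (conformalChange f R.toFun) φ) j x y * y i =
      sprayCoeff (coordExpr R.toFun φ) i x y * y j -
        sprayCoeff (coordExpr R.toFun φ) j x y * y i -
      (1 / 2) * (A x y y * (fs i * y j - fs j * y i) + √(A x y y) *
        (B x y * (fs i * y j - fs j * y i) - df y * (bs i * y j - bs j * y i))) :=
    fun i j y hy => sprayCoeff_randersNorm_exp_mul hsymm hpos (R.randersNorm_pos hφ hx hy) hy
      (R.differentiableAt_coordMetric hφ hx) (R.differentiableAt_coordForm hφ hx)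
      (differentiableAt_comp_symm hφ hx hf) hfs hbs i j
  have hsum : ∀ (θ : EuclideanSpace ℝ (Fin n) →L[ℝ] ℝ) (y : EuclideanSpace ℝ (Fin n)),
      ∑ k, θ (EuclideanSpace.single k 1) * y k = θ y := sum_coord_mul_apply_single
  have hquad : ∀ i j, ∃ Q : MvPolynomial (Fin n) ℝ, Q.IsHomogeneous 3 ∧
      ∀ y : EuclideanSpace ℝ (Fin n), MvPolynomial.eval (fun k => y k) Q =
        (1 / 2) * (A x y y * (fs i * y j - fs j * y i)) := fun i j => by
    refine ⟨(∑ k, ∑ l, MvPolynomial.C (1 / 2 * A x (EuclideanSpace.single k 1)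
      (EuclideanSpace.single l 1)) * MvPolynomial.X l * MvPolynomial.X k) *
        (MvPolynomial.C (fs i) * MvPolynomial.X j - MvPolynomial.C (fs j) * MvPolynomial.X i),
      ?_, fun y => ?_⟩
    · refine MvPolynomial.IsHomogeneous.mul (m := 2) (n := 1) ?_ ?_
      · exact MvPolynomial.IsHomogeneous.sum _ _ _ fun k _ =>
          MvPolynomial.IsHomogeneous.sum _ _ _ fun l _ =>
          (MvPolynomial.isHomogeneous_C_mul_X _ _).mul (MvPolynomial.isHomogeneous_X _ _)
      · exact (MvPolynomial.isHomogeneous_C_mul_X _ _).sub (MvPolynomial.isHomogeneous_C_mul_X _ _)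
    · have : A x y y = ∑ k, ∑ l, A x (EuclideanSpace.single k 1) (EuclideanSpace.single l 1) *
          y l * y k := by
        simp only [← Finset.sum_mul, hsum]
        exact (hsum ((A x).flip y) y).symm
      simp only [map_mul, map_sub, map_sum, MvPolynomial.eval_C, MvPolynomial.eval_X, this]
      rw [← mul_assoc]
      congr 1
      simp only [Finset.mul_sum]
      exact Finset.sum_congr rfl fun k _ => Finset.sum_congr rfl fun l _ => by ring
  have hwedge : (∀ i j, coordPartial φ f i x * R.coordB φ j x -
      coordPartial φ f j x * R.coordB φ i x = 0) ↔
      ∀ i j (y : EuclideanSpace ℝ (Fin n)), y ≠ 0 →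
        B x y * (fs i * y j - fs j * y i) - df y * (bs i * y j - bs j * y i) = 0 := by
    have hc : ∀ i, coordPartial φ f i x = df (EuclideanSpace.single i 1) := fun i => rfl
    have hb : ∀ i, R.coordB φ i x = B x (EuclideanSpace.single i 1) := fun i => rfl
    simp only [hc, hb]
    have hvec : ∀ y u, A x (B x y • fs - df y • bs) u = B x y * df u - df y * B x u :=
      fun y u => by simp [hfs, hbs]
    have hzero : ∀ u, (∀ v, A x u v = 0) → u = 0 := fun u hu => by
      by_contra h
      exact (hpos u h).ne' (hu u)
    constructor
    · intro h i j y _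
      -- The pairing of this vector with u is ∑ yₖ uₗ (bₖ fₗ − fₖ bₗ), which vanishes termwise;
      -- positivity of A does the rest.
      have hz : B x y • fs - df y • bs = 0 := hzero _ fun u => by
        rw [hvec, ← hsum (B x) y, ← hsum df y, ← hsum (B x) u, ← hsum df u,
          Finset.sum_mul_sum, Finset.sum_mul_sum, ← Finset.sum_sub_distrib]
        refine Finset.sum_eq_zero fun k _ => ?_
        rw [← Finset.sum_sub_distrib]
        exact Finset.sum_eq_zero fun l _ => by linear_combination -(y k * u l) * h k l
      have hk : ∀ k, B x y * fs k = df y * bs k := fun k => by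
        have := congrArg (fun w : EuclideanSpace ℝ (Fin n) => w k) hz
        simpa [sub_eq_zero] using this
      linear_combination y j * hk i - y i * hk j
    · intro h i j
      have hy : (EuclideanSpace.single j 1 : EuclideanSpace ℝ (Fin n)) ≠ 0 := by simp
      -- With y = eⱼ, pairing w with eᵢ gives fᵢbⱼ − fⱼbᵢ. Being parallel and A-orthogonal to y ≠ 0,
      -- w vanishes.
      generalize EuclideanSpace.single j (1 : ℝ) = y at *
      set w := B x y • fs - df y • bs with hw
      have hpar : ∀ i j, w i * y j = w j * y i := fun i j => by
        simp only [hw, PiLp.sub_apply, PiLp.smul_apply, smul_eq_mul]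
        linear_combination h i j y hy
      have horth : A x w y = 0 := by rw [hw, hvec]; ring
      obtain ⟨k, hk⟩ : ∃ k, y k ≠ 0 := by
        by_contra! h0
        exact hy (by ext k; simpa using h0 k)
      have hwy : y k • w = w k • y := by
        ext l
        simp only [PiLp.smul_apply, smul_eq_mul]
        linear_combination hpar l k
      have hwk : w k = 0 := by
        have : A x (y k • w) y = A x (w k • y) y := by rw [hwy]
        simp only [map_smul, smul_apply, smul_eq_mul, horth, mul_zero] at this
        exact (mul_eq_zero.1 this.symm).resolve_right (hpos y hy).ne'
      have hw0 : w = 0 := by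
        rw [hwk, zero_smul] at hwy
        exact (smul_eq_zero.1 hwy).resolve_left hk
      have := hvec y (EuclideanSpace.single i 1)
      rw [← hw, hw0] at this
      simp at this
      linear_combination -this
  rw [hwedge]
  refine forall_congr' fun i => forall_congr' fun j => ?_
  obtain ⟨P, hP, hPe⟩ := hR φ hφ x hx i j
  obtain ⟨Q, hQ, hQe⟩ := hquad i j
  constructor
  · rintro ⟨P', hP', hPe'⟩ y hy
    have hodd : ∀ z : EuclideanSpace ℝ (Fin n), z ≠ 0 → √(A x z z) *
        (B x z * (fs i * z j - fs j * z i) - df z * (bs i * z j - bs j * z i)) =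
        2 * MvPolynomial.eval (fun k => z k) (P - Q - P') := fun z hz => by
      rw [map_sub, map_sub, ← hPe z hz, hQe, ← hPe' z hz, key i j z hz]
      ring
    have h1 := hodd y hy
    have h2 := hodd (-y) (neg_ne_zero.2 hy)
    have h3 := ((hP.sub hQ).sub hP').eval_neg_of_odd (by decide) (fun k => y k)
    simp only [PiLp.neg_apply, h3, map_neg, neg_apply, neg_neg] at h2
    have hr := Real.sqrt_pos.2 (hpos y hy)
    refine (mul_eq_zero.1 ?_).resolve_left hr.ne'
    -- The same even quantity equals an odd polynomial at y and at −y; averaging leaves zero.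
    linear_combination (h1 + h2) / 2
  · intro h
    refine ⟨P - Q, hP.sub hQ, fun y hy => ?_⟩
    rw [key i j y hy, hPe y hy, h y hy, map_sub, hQe]
    ring
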